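/- Let \(n \ge 0\) and let \(\mathrm{Aff}(n,\mathbb{C})\) be the group, under composition, of the affine transformations \(g=(A,v)\colon x \mapsto Ax+v\) of \(\mathbb{C}^n\), with linear part \(L(g)=A \in \mathrm{GL}(n,\mathbb{C})\) and \(v \in \mathbb{C}^n\). Write \(\overline{g}=(\overline{A},\overline{v})\) (entrywise complex conjugation) and \(e=(I_n,0)\). An element \(h \in \mathrm{Aff}(n,\mathbb{C})\) is a coninvolution if \(h\overline{h}=e\). For every \(g \in \mathrm{Aff}(n,\mathbb{C})\) the following are equivalent: (i) \(g\) is \(c\)-reversible, i.e. there exists \(h \in \mathrm{Aff}(n,\mathbb{C})\) with \(hgh^{-1}=\overline{g}^{-1}\); (ii) \(g\) is strongly \(c\)-reversible, i.e. there exists a coninvolution \(h \in \mathrm{Aff}(n,\mathbb{C})\) with \(hgh^{-1}=\overline{g}^{-1}\); (ii') \(g\) is a product of two coninvolutions: \(g=ab\) with \(a,b \in \mathrm{Aff}(n,\mathbb{C})\), \(a\overline{a}=e\) and \(b\overline{b}=e\); (iii) \(L(g)\) is \(c\)-reversible in \(\mathrm{GL}(n,\mathbb{C})\), i.e. there exists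 \(B \in \mathrm{GL}(n,\mathbb{C})\) with \(B\,L(g)\,B^{-1}=\overline{L(g)}^{-1}\). -/

import Mathlib

open Matrix

noncomputable section

/-- The group `Aff(n, ℂ)` of invertible affine transformations of `ℂⁿ`. The multiplication is
composition and `1` is the identity map. -/
abbrev Aff (n : ℕ) : Type := (Fin n → ℂ) ≃ᵃ[ℂ] (Fin n → ℂ)

namespace Aff

variable {n : ℕ}

/-- Invertible matrices as linear automorphisms of `ℂⁿ`, `A ↦ (x ↦ A x)`. -/
def glEquiv (n : ℕ) : GL (Fin n) ℂ ≃* ((Fin n → ℂ) ≃ₗ[ℂ] (Fin n → ℂ)) :=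
  Matrix.GeneralLinearGroup.toLin.trans
    (LinearMap.GeneralLinearGroup.generalLinearEquiv ℂ (Fin n → ℂ))

theorem glEquiv_apply (A : GL (Fin n) ℂ) (x : Fin n → ℂ) :
    glEquiv n A x = (A : Matrix (Fin n) (Fin n) ℂ) *ᵥ x := rfl

/-- The affine transformation `(A, v) : x ↦ A x + v`. -/
def mk (A : GL (Fin n) ℂ) (v : Fin n → ℂ) : Aff n :=
  AffineEquiv.mk' (fun x => (A : Matrix (Fin n) (Fin n) ℂ) *ᵥ x + v) (glEquiv n A) 0
    (fun x => by simp [glEquiv_apply])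

/-- The linear part `L(g) = A` of `g = (A, v)`, as an element of `GL(n, ℂ)`. -/
def linearPart (g : Aff n) : GL (Fin n) ℂ := (glEquiv n).symm g.linear

/-- The translation part `v = g(0)` of `g = (A, v)`. -/
def translationPart (g : Aff n) : Fin n → ℂ := g 0

theorem mk_apply (A : GL (Fin n) ℂ) (v x : Fin n → ℂ) :
    mk A v x = (A : Matrix (Fin n) (Fin n) ℂ) *ᵥ x + v := rfl

theorem linearPart_mk (A : GL (Fin n) ℂ) (v : Fin n → ℂ) : linearPart (mk A v) = A :=
  (glEquiv n).symm_apply_apply A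

theorem translationPart_mk (A : GL (Fin n) ℂ) (v : Fin n → ℂ) : translationPart (mk A v) = v := by
  simp [translationPart, mk_apply]

theorem mk_parts (g : Aff n) : mk (linearPart g) (translationPart g) = g := by
  ext1 x
  have h : (linearPart g : Matrix (Fin n) (Fin n) ℂ) *ᵥ x = g.linear x := by
    rw [← glEquiv_apply, linearPart, MulEquiv.apply_symm_apply]
  have h2 := g.map_vadd 0 x
  rw [mk_apply, h, translationPart]
  simpa using h2.symm

/-- The entrywise complex conjugate of an invertible matrix. -/
def conjGL (A : GL (Fin n) ℂ) : GL (Fin n) ℂ :=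
  Matrix.GeneralLinearGroup.map (starRingEnd ℂ) A

/-- The complex conjugate `(Ā, v̄)` of `g = (A, v)`. -/
def conj (g : Aff n) : Aff n :=
  mk (conjGL (linearPart g)) (star (translationPart g))

theorem conj_mk (A : GL (Fin n) ℂ) (v : Fin n → ℂ) : conj (mk A v) = mk (conjGL A) (star v) := by
  rw [conj, linearPart_mk, translationPart_mk]

/-- `g` is `c`-reversible: it is conjugate to `ḡ⁻¹` in `Aff(n, ℂ)`. -/
def IsCReversible (g : Aff n) : Prop :=
  ∃ h : Aff n, h * g * h⁻¹ = (conj g)⁻¹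

/-- `h` is a coninvolution: `h h̄ = e`. -/
def IsConinvolution (h : Aff n) : Prop := h * conj h = 1

/-- `g` is strongly `c`-reversible: it is conjugated to `ḡ⁻¹` by a coninvolution. -/
def IsStronglyCReversible (g : Aff n) : Prop :=
  ∃ h : Aff n, h * g * h⁻¹ = (conj g)⁻¹ ∧ IsConinvolution h

/-- `A` is `c`-reversible in `GL(n, ℂ)`: it is conjugate to `Ā⁻¹` in `GL(n, ℂ)`. -/
def IsCReversibleGL (A : GL (Fin n) ℂ) : Prop :=
  ∃ B : GL (Fin n) ℂ, B * A * B⁻¹ = (conjGL A)⁻¹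

end Aff

end

/-! Identify `h` with the antilinear-affine map `κ = conj ∘ h`: then `h` is a coninvolution iff `κ²
= 1`, and it reverses `g` iff `g κ g = κ`. For `g = (A, v)` and `κ` with linear part `K` and fixed
point `w`, this asks for `K² = 1`, `A K A = K` and `A K v' = -v'`, where `v' = v + (A - 1)w`. So an
antilinear bijection `k` with `A k A = k` must be improved to an involution adapted to the class of
`v` modulo the range of `A - 1`.

A Cayley transform `M = i(ζ + A)(ζ - A)⁻¹`, with `|ζ| = 1` off the spectrum of `A`, turns reversing
`A` into commuting with `M`, and the eigenvalue 1 into a real `μ`. What remains is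
`HasAdaptedRealStructure.of_antilinear`. There `k` exchanges the spectral parts of `M` in the upper
and lower half planes, so an involution on their sum comes from `k` and its inverse. On the real
part, cyclic blocks split off one at a time, the first generated by a representative of the given
class; conjugating coordinates fixes that generator. -/

/-- Some antilinear involution of `V` commutes with `M` and fixes a vector congruent to `u`
modulo the range of `M - μ`. -/
def HasAdaptedRealStructure {V : Type*} [AddCommGroup V] [Module ℂ V] (M : Module.End ℂ V)
    (μ : ℂ) (u : V) : Prop :=
  ∃ k : V →ₛₗ[starRingEnd ℂ] V, (∀ x, k (k x) = x) ∧ (∀ x, k (M x) = M (k x)) ∧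
    ∃ w, k (u + (M w - μ • w)) = u + (M w - μ • w)

namespace HasAdaptedRealStructure

variable {V W : Type*} [AddCommGroup V] [Module ℂ V] [AddCommGroup W] [Module ℂ W]

theorem of_equiv (e : V ≃ₗ[ℂ] W) {M : Module.End ℂ V} {M' : Module.End ℂ W}
    (he : ∀ x, e (M x) = M' (e x)) {μ : ℂ} {u : V} (h : HasAdaptedRealStructure M' μ (e u)) :
    HasAdaptedRealStructure M μ u := by
  obtain ⟨k, hk, hkM, w, hw⟩ := h
  have he' : ∀ y, e.symm (M' y) = M (e.symm y) := fun y => by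
    rw [LinearEquiv.symm_apply_eq, he, e.apply_symm_apply]
  have hu : e (u + (M (e.symm w) - μ • e.symm w)) = e u + (M' w - μ • w) := by
    simp [he]
  refine ⟨e.symm.toLinearMap.comp (k.comp e.toLinearMap), fun x => ?_, fun x => ?_,
    e.symm w, ?_⟩
  · simp [hk]
  · simp [he, hkM, he']
  · change e.symm (k (e (u + (M (e.symm w) - μ • e.symm w)))) = _
    rw [hu, hw, ← hu, e.symm_apply_apply]

theorem prod {M : Module.End ℂ V} {M' : Module.End ℂ W} {μ : ℂ} {u : V} {u' : W}
    (h : HasAdaptedRealStructure M μ u) (h' : HasAdaptedRealStructure M' μ u') :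
    HasAdaptedRealStructure (M.prodMap M') μ (u, u') := by
  obtain ⟨k, hk, hkM, w, hw⟩ := h
  obtain ⟨k', hk', hkM', w', hw'⟩ := h'
  refine ⟨{ toFun := fun x => (k x.1, k' x.2), map_add' := ?_, map_smul' := ?_ }, ?_, ?_,
    (w, w'), ?_⟩
  · intro x y; simp
  · intro c x; simp
  · intro x; simp [hk, hk']
  · intro x; simp [hkM, hkM']
  · exact Prod.ext hw hw'

end HasAdaptedRealStructure

/-! ### Splitting off cyclic blocks; real spectrum. -/

/-- A vector outside the range of `N` that is congruent modulo the range to a vector generating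
a cyclic block on which `N` is nilpotent, together with a functional splitting that block off. -/
theorem Module.End.exists_split_cyclic {V : Type*} [AddCommGroup V] [Module ℂ V]
    [FiniteDimensional ℂ V] (N : Module.End ℂ V) {u : V} (hu : ∀ w, N w ≠ u) :
    ∃ (m : ℕ) (w : V) (φ : V →ₗ[ℂ] ℂ), (N ^ (m + 1)) (u + N w) = 0 ∧
      φ ((N ^ m) (u + N w)) = 1 ∧ ∀ y, φ ((N ^ (m + 1)) y) = 0 := by
  have hex : ∃ j, ∃ w, (N ^ j) (u + N w) = 0 := by
    obtain ⟨n, hn⟩ := (LinearMap.eventually_isCompl_ker_pow_range_pow N).exists_forall_of_atTop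
    have hc := hn (n + 1) (Nat.le_succ n)
    have hu' : u ∈ LinearMap.ker (N ^ (n + 1)) ⊔ LinearMap.range (N ^ (n + 1)) := by
      rw [hc.sup_eq_top]; trivial
    obtain ⟨a, ha, b, ⟨z, rfl⟩, hab⟩ := Submodule.mem_sup.1 hu'
    -- Fitting decomposition: the component of `u` in the range of `N ^ (n + 1)` is `N (N ^ n z)`,
    -- so this choice removes it.
    refine ⟨n + 1, -(N ^ n) z, ?_⟩
    have : u + N (-(N ^ n) z) = a := by
      rw [← hab, pow_succ' N n]; simp
    rw [this]; exact ha
  classical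
  obtain ⟨w, hw⟩ := Nat.find_spec hex
  have hmin : ∀ j, j < Nat.find hex → ∀ w, (N ^ j) (u + N w) ≠ 0 := fun j hj w h =>
    Nat.find_min hex hj ⟨w, h⟩
  have hpos : Nat.find hex ≠ 0 := by
    intro h0
    rw [h0] at hw
    apply hu (-w)
    have : u + N w = 0 := by simpa using hw
    rw [map_neg, neg_eq_iff_add_eq_zero, add_comm]; exact this
  obtain ⟨m, hm⟩ := Nat.exists_eq_succ_of_ne_zero hpos
  rw [hm] at hw hmin
  -- Otherwise correcting `w` by a preimage would kill the vector already at exponent `m`, against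
  -- minimality.
  have hnot : (N ^ m) (u + N w) ∉ LinearMap.range (N ^ (m + 1)) := by
    rintro ⟨z, hz⟩
    refine hmin m (Nat.lt_succ_self m) (w - z) ?_
    have : u + N (w - z) = (u + N w) - N z := by rw [map_sub]; abel
    rw [this, map_sub, ← hz, pow_succ]; simp
  obtain ⟨f, hf, hfr⟩ := Submodule.exists_le_ker_of_notMem hnot
  refine ⟨m, w, (f ((N ^ m) (u + N w)))⁻¹ • f, hw, ?_, fun y => ?_⟩
  · rw [LinearMap.smul_apply, smul_eq_mul, inv_mul_cancel₀ hf]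
  · have : f ((N ^ (m + 1)) y) = 0 := hfr ⟨y, rfl⟩
    simp [this]

/-- A cyclic nilpotent block and the complement cut out by a splitting functional. -/
theorem Module.End.exists_equiv_cyclic_prod {V : Type*} [AddCommGroup V] [Module ℂ V]
    (N : Module.End ℂ V) {m : ℕ} {x : V} {φ : V →ₗ[ℂ] ℂ} {q : Submodule ℂ V}
    (hx : (N ^ (m + 1)) x = 0) (hφx : φ ((N ^ m) x) = 1)
    (hq : ∀ y, y ∈ q ↔ ∀ i : Fin (m + 1), φ ((N ^ (i : ℕ)) y) = 0) :
    ∃ e : ((Fin (m + 1) → ℂ) × q) ≃ₗ[ℂ] V,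
      ∀ c y, e (c, y) = ∑ i, c i • (N ^ (i : ℕ)) x + y := by
  let S : (Fin (m + 1) → ℂ) →ₗ[ℂ] V := Fintype.linearCombination ℂ fun i => (N ^ (i : ℕ)) x
  let T : V →ₗ[ℂ] (Fin (m + 1) → ℂ) := LinearMap.pi fun i => φ.comp (N ^ (i : ℕ))
  have hS : ∀ c, S c = ∑ i, c i • (N ^ (i : ℕ)) x := fun c => rfl
  have hT : ∀ y, y ∈ q ↔ T y = 0 := fun y => by
    rw [hq, funext_iff]; rfl
  have hvan : ∀ i, m < i → (N ^ i) x = 0 := by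
    intro i hi
    obtain ⟨d, rfl⟩ := Nat.exists_eq_add_of_le' hi
    rw [pow_add, Module.End.mul_apply, hx, map_zero]
  have hinj : Function.Injective (T.comp S) := by
    rw [← LinearMap.ker_eq_bot, LinearMap.ker_eq_bot']
    intro c hc
    have key : ∀ i : ℕ, ∀ hi : i < m + 1, c ⟨i, hi⟩ = 0 := by
      intro i
      induction i using Nat.strong_induction_on with
      | _ i ih =>
        intro hi
        -- The matrix `φ (N ^ (j + l) x)` is antitriangular with ones on the antidiagonal `j + l =
        -- m`; row `m - i` isolates `c i` once the earlier coefficients vanish.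
        have h1 : T (S c) ⟨m - i, by omega⟩ = 0 := congrFun hc _
        have h2 : T (S c) ⟨m - i, by omega⟩ =
            ∑ l, c l * φ ((N ^ (m - i + (l : ℕ))) x) := by
          simp [T, hS, pow_add, map_sum]
        rw [h2, Finset.sum_eq_single ⟨i, hi⟩] at h1
        · have : m - i + i = m := by omega
          simpa [this, hφx] using h1
        · intro l _ hl
          rcases lt_or_gt_of_ne (fun h : (l : ℕ) = i => hl (Fin.ext h)) with h | h
          · rw [ih l h l.2, zero_mul]
          · rw [hvan _ (by omega), map_zero, mul_zero]
        · simp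
    funext i
    exact key i i.2
  have hsurj : Function.Surjective (T.comp S) := LinearMap.injective_iff_surjective.1 hinj
  have hbij : Function.Bijective (S.coprod q.subtype) := by
    constructor
    · rw [← LinearMap.ker_eq_bot, LinearMap.ker_eq_bot']
      rintro ⟨c, y⟩ h
      have h' : S c + y = 0 := by simpa using h
      have hc : c = 0 := by
        apply hinj
        have := congrArg T h'
        rw [map_add, (hT y).1 y.2] at this
        simpa using this
      subst hc
      simpa using h'
    · intro z
      obtain ⟨c, hc⟩ := hsurj (T z)
      refine ⟨(c, ⟨z - S c, (hT _).2 ?_⟩), ?_⟩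
      · rw [map_sub, ← hc]; simp
      · simp
  exact ⟨LinearEquiv.ofBijective _ hbij, fun c y => by simp [hS]⟩

/-- Conjugate the coordinates in the basis `N ^ i x`, with `N = M - μ`, and use the given involution
on `q`. Since `N` shifts the basis and `μ` is real, the result commutes with `M`. -/
theorem HasAdaptedRealStructure.of_cyclic_prod {V : Type*} [AddCommGroup V] [Module ℂ V]
    {M : Module.End ℂ V} {μ : ℂ} (hμ : starRingEnd ℂ μ = μ) {m : ℕ} {x : V}
    {q : Submodule ℂ V} (hqM : ∀ y ∈ q, M y ∈ q) (hx : ((M - algebraMap ℂ _ μ) ^ (m + 1)) x = 0)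
    (e : ((Fin (m + 1) → ℂ) × q) ≃ₗ[ℂ] V)
    (he : ∀ c y, e (c, y) = ∑ i, c i • ((M - algebraMap ℂ _ μ) ^ (i : ℕ)) x + y)
    (h : HasAdaptedRealStructure (M.restrict hqM) μ 0) :
    ∃ k : V →ₛₗ[starRingEnd ℂ] V, (∀ x, k (k x) = x) ∧ (∀ x, k (M x) = M (k x)) ∧ k x = x := by
  set N : Module.End ℂ V := M - algebraMap ℂ _ μ with hN
  obtain ⟨k, hk, hkM, -⟩ := h
  let k₀ : ((Fin (m + 1) → ℂ) × q) →ₛₗ[starRingEnd ℂ] ((Fin (m + 1) → ℂ) × q) :=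
    { toFun := fun p => (star p.1, k p.2)
      map_add' := fun a b => by simp
      map_smul' := fun c a => by simp }
  let K : V →ₛₗ[starRingEnd ℂ] V := e.toLinearMap.comp (k₀.comp e.symm.toLinearMap)
  have hKe : ∀ c y, K (e (c, y)) = e (star c, k y) := fun c y => by simp [K, k₀]
  have hKp : ∀ (i : ℕ) (c : ℂ), K (c • (N ^ i) x) = starRingEnd ℂ c • (N ^ i) x := by
    intro i c
    by_cases hi : i < m + 1
    · have h1 : ∀ c : ℂ, c • (N ^ i) x = e (Pi.single ⟨i, hi⟩ c, 0) := fun c => by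
        rw [he, Finset.sum_eq_single ⟨i, hi⟩]
        · simp
        · intro b _ hb; simp [hb]
        · simp
      rw [h1, hKe, h1, map_zero, Pi.star_single]; rfl
    · obtain ⟨d, rfl⟩ := Nat.exists_eq_add_of_le' (not_lt.1 hi)
      rw [pow_add, Module.End.mul_apply, hx, map_zero]; simp
  have hMN : ∀ y, M y = N y + μ • y := fun y => by simp [hN]
  have hq0 : ∀ y : q, K y = k y := fun y => by
    have h1 : ∀ y : q, (y : V) = e (0, y) := fun y => by rw [he]; simp
    rw [h1, hKe, star_zero, ← h1]
  have hsum : ∀ c : Fin (m + 1) → ℂ, K (N (∑ i, c i • (N ^ (i : ℕ)) x)) =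
      N (K (∑ i, c i • (N ^ (i : ℕ)) x)) := by
    intro c
    have : ∀ i : ℕ, N ((N ^ i) x) = (N ^ (i + 1)) x := fun i => by
      rw [pow_succ', Module.End.mul_apply]
    simp only [map_sum, map_smul, this, hKp]
  refine ⟨K, fun z => ?_, fun z => ?_, ?_⟩
  · obtain ⟨⟨c, y⟩, rfl⟩ := e.surjective z
    rw [hKe, hKe, star_star, hk]
  · obtain ⟨⟨c, y⟩, rfl⟩ := e.surjective z
    have h2 : K (M y) = M (K y) := by
      have := hq0 (M.restrict hqM y)
      rw [hkM] at this
      rw [hq0]; exact this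
    rw [he, map_add, map_add, map_add, map_add, h2, hMN (∑ i, _), hMN (K (∑ i, _)), map_add, hsum,
      map_smulₛₗ, hμ]
  · simpa using hKp 0 1

/-- Induction on dimension: a vector outside the range of `M - μ` yields a cyclic block, and its
complement is smaller. -/
theorem HasAdaptedRealStructure.of_real_spectrum {V : Type*} [AddCommGroup V] [Module ℂ V]
    [FiniteDimensional ℂ V] (M : Module.End ℂ V)
    (hM : ∀ l, M.HasEigenvalue l → starRingEnd ℂ l = l) (μ : ℂ) (hμ : starRingEnd ℂ μ = μ)
    (u : V) : HasAdaptedRealStructure M μ u := by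
  induction hd : Module.finrank ℂ V using Nat.strong_induction_on generalizing V μ with
  | _ d ih =>
  have main : ∀ μ : ℂ, starRingEnd ℂ μ = μ → ∀ u : V,
      (∀ w, (M - algebraMap ℂ (Module.End ℂ V) μ) w ≠ u) → HasAdaptedRealStructure M μ u := by
    intro μ hμ u hu
    set N : Module.End ℂ V := M - algebraMap ℂ _ μ with hN
    obtain ⟨m, w, φ, hx, hφx, hφ⟩ := N.exists_split_cyclic hu
    let q : Submodule ℂ V :=
      LinearMap.ker (LinearMap.pi fun i : Fin (m + 1) => φ.comp (N ^ (i : ℕ)))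
    have hq : ∀ y, y ∈ q ↔ ∀ i : Fin (m + 1), φ ((N ^ (i : ℕ)) y) = 0 := fun y => by
      rw [LinearMap.mem_ker, funext_iff]; rfl
    have hMN : ∀ y, M y = N y + μ • y := fun y => by simp [hN]
    have hqM : ∀ y ∈ q, M y ∈ q := by
      intro y hy
      rw [hMN]
      refine q.add_mem ((hq _).2 fun i => ?_) (q.smul_mem _ hy)
      rw [← Module.End.mul_apply, ← pow_succ]
      by_cases hi : (i : ℕ) + 1 < m + 1
      · exact (hq y).1 hy ⟨i + 1, hi⟩
      -- Invariance at the last index holds because `φ` kills the range of `N ^ (m + 1)`.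
      · have : (i : ℕ) + 1 = m + 1 := by omega
        rw [this, hφ]
    obtain ⟨e, he⟩ := N.exists_equiv_cyclic_prod hx hφx hq
    have hlt : Module.finrank ℂ q < d := by
      have := e.finrank_eq
      rw [Module.finrank_prod, Module.finrank_fin_fun, hd] at this
      omega
    have hqs : ∀ l, Module.End.HasEigenvalue (M.restrict hqM) l → starRingEnd ℂ l = l := by
      intro l hl
      obtain ⟨y, hy⟩ := hl.exists_hasEigenvector
      refine hM l (Module.End.hasEigenvalue_of_hasEigenvector (x := (y : V)) ⟨?_, ?_⟩)
      · rw [Module.End.mem_eigenspace_iff]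
        exact congrArg Subtype.val hy.apply_eq_smul
      · simpa using hy.2
    obtain ⟨k, hk, hkM, hkx⟩ := of_cyclic_prod hμ hqM hx e he (ih _ hlt _ hqs μ hμ 0 rfl)
    refine ⟨k, hk, hkM, w, ?_⟩
    have : M w - μ • w = N w := by simp [hN]
    rw [this, hkx]
  by_cases hu : ∀ w, (M - algebraMap ℂ (Module.End ℂ V) μ) w ≠ u
  · exact main μ hμ u hu
  · push Not at hu
    obtain ⟨w, hw⟩ := hu
    have h0 : u + (M (-w) - μ • (-w)) = 0 := by
      rw [← hw]; simp
    -- The class of `u` is zero, so any commuting involution will do; one comes from `main` at an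
    -- arbitrary eigenvalue.
    suffices ∃ k : V →ₛₗ[starRingEnd ℂ] V, (∀ x, k (k x) = x) ∧ ∀ x, k (M x) = M (k x) by
      obtain ⟨k, hk, hkM⟩ := this
      exact ⟨k, hk, hkM, -w, by rw [h0, map_zero]⟩
    rcases subsingleton_or_nontrivial V with hV | hV
    · exact ⟨0, fun x => Subsingleton.elim _ _, fun x => Subsingleton.elim _ _⟩
    · obtain ⟨l, hl⟩ := Module.End.exists_eigenvalue M
      have hns : ¬ Function.Surjective (M - algebraMap ℂ (Module.End ℂ V) l) := by
        intro hs
        have hi := LinearMap.injective_iff_surjective.2 hs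
        obtain ⟨y, hy⟩ := hl.exists_hasEigenvector
        apply hy.2
        apply hi
        simp [hy.apply_eq_smul]
      rw [Function.Surjective] at hns
      push Not at hns
      obtain ⟨y, hy⟩ := hns
      obtain ⟨k, hk, hkM, -⟩ := main l (hM l hl) y hy
      exact ⟨k, hk, hkM⟩

/-! ### Spectral parts and the passage to arbitrary spectrum. -/

/-- The sum of the generalized eigenspaces of `M` for the eigenvalues in `S`. -/
def Module.End.spectralPart {V : Type*} [AddCommGroup V] [Module ℂ V] (M : Module.End ℂ V)
    (S : Set ℂ) : Submodule ℂ V :=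
  ⨆ l ∈ S, M.maxGenEigenspace l

namespace Module.End

variable {V : Type*} [AddCommGroup V] [Module ℂ V] (M : Module.End ℂ V)

theorem spectralPart_union (S T : Set ℂ) :
    M.spectralPart (S ∪ T) = M.spectralPart S ⊔ M.spectralPart T :=
  iSup_union

theorem spectralPart_univ [FiniteDimensional ℂ V] : M.spectralPart Set.univ = ⊤ := by
  simp [spectralPart, iSup_maxGenEigenspace_eq_top]

theorem disjoint_spectralPart {S T : Set ℂ} (h : Disjoint S T) :
    Disjoint (M.spectralPart S) (M.spectralPart T) :=
  M.independent_maxGenEigenspace.disjoint_biSup_biSup h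

theorem apply_mem_spectralPart {S : Set ℂ} : ∀ x ∈ M.spectralPart S, M x ∈ M.spectralPart S := by
  have : M.spectralPart S ≤ (M.spectralPart S).comap M :=
    iSup₂_le fun l hl x hx => le_iSup₂_of_le (f := fun l (_ : l ∈ S) => M.maxGenEigenspace l) l hl
      le_rfl (M.mapsTo_maxGenEigenspace_of_comm (Commute.refl M) l hx)
  exact this

theorem antilinear_mem_spectralPart {k : V →ₛₗ[starRingEnd ℂ] V} (hk : ∀ x, k (M x) = M (k x))
    {S T : Set ℂ} (hST : ∀ l ∈ S, starRingEnd ℂ l ∈ T) :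
    ∀ x ∈ M.spectralPart S, k x ∈ M.spectralPart T := by
  have : M.spectralPart S ≤ (M.spectralPart T).comap k := by
    refine iSup₂_le fun l hl x hx => ?_
    refine le_iSup₂_of_le (f := fun l (_ : l ∈ T) => M.maxGenEigenspace l) _ (hST l hl)
      le_rfl ?_
    rw [mem_maxGenEigenspace] at hx ⊢
    obtain ⟨n, hn⟩ := hx
    have key : ∀ (n : ℕ) y, k (((M - l • (1 : Module.End ℂ V)) ^ n) y) =
        ((M - starRingEnd ℂ l • (1 : Module.End ℂ V)) ^ n) (k y) := by
      intro n
      induction n with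
      | zero => intro y; simp
      | succ n ih =>
        intro y
        rw [pow_succ, pow_succ, mul_apply, mul_apply, ih]
        simp [hk]
    exact ⟨n, by rw [← key, hn, map_zero]⟩
  exact this

theorem eq_zero_of_mem_spectralPart {S : Set ℂ} {l : ℂ} (hl : l ∉ S) {x : V}
    (hx : x ∈ M.spectralPart S) (h : M x = l • x) : x = 0 := by
  have h1 : x ∈ M.spectralPart {l} := by
    rw [spectralPart, iSup_singleton, mem_maxGenEigenspace]
    exact ⟨1, by simp [h]⟩
  exact Submodule.disjoint_def.1
    (M.disjoint_spectralPart (Set.disjoint_singleton_right.2 hl)) x hx h1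

theorem exists_restrict_spectralPart_eq [FiniteDimensional ℂ V] {S : Set ℂ} {μ : ℂ} (hμ : μ ∉ S)
    (u : M.spectralPart S) : ∃ w, M.restrict M.apply_mem_spectralPart w - μ • w = u := by
  let f : Module.End ℂ (M.spectralPart S) :=
    M.restrict M.apply_mem_spectralPart - algebraMap ℂ _ μ
  have hf : Function.Injective f := by
    rw [← LinearMap.ker_eq_bot, LinearMap.ker_eq_bot']
    intro x hx
    refine Subtype.ext (M.eq_zero_of_mem_spectralPart hμ x.2 ?_)
    have : M x - μ • (x : V) = 0 := congrArg Subtype.val hx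
    exact sub_eq_zero.1 this
  exact LinearMap.injective_iff_surjective.1 hf u

end Module.End

theorem HasAdaptedRealStructure.of_disjoint_isCompl {V : Type*} [AddCommGroup V] [Module ℂ V]
    {M : Module.End ℂ V} {p q r : Submodule ℂ V} (hqr : Disjoint q r) (hp : IsCompl p (q ⊔ r))
    (hpM : ∀ x ∈ p, M x ∈ p) (hqM : ∀ x ∈ q, M x ∈ q) (hrM : ∀ x ∈ r, M x ∈ r) {μ : ℂ}
    (h : ∀ u, HasAdaptedRealStructure (M.restrict hpM) μ u)
    (h' : ∀ u, HasAdaptedRealStructure ((M.restrict hqM).prodMap (M.restrict hrM)) μ u) (u : V) :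
    HasAdaptedRealStructure M μ u := by
  let f : (p × (q × r)) →ₗ[ℂ] V := p.subtype.coprod (q.subtype.coprod r.subtype)
  have hf : ∀ a b c, f (a, (b, c)) = (a : V) + (b + c) := fun a b c => by simp [f]
  have hbij : Function.Bijective f := by
    constructor
    · rw [← LinearMap.ker_eq_bot, LinearMap.ker_eq_bot']
      rintro ⟨a, b, c⟩ h0
      rw [hf] at h0
      have hbc : (b : V) + c ∈ q ⊔ r := Submodule.add_mem_sup b.2 c.2
      have ha : (a : V) = 0 := Submodule.disjoint_def.1 hp.disjoint _ a.2 (by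
        rw [eq_neg_of_add_eq_zero_left h0]; exact Submodule.neg_mem _ hbc)
      rw [ha, zero_add] at h0
      have hb : (b : V) = 0 := Submodule.disjoint_def.1 hqr _ b.2 (by
        rw [eq_neg_of_add_eq_zero_left h0]; exact Submodule.neg_mem _ c.2)
      rw [hb, zero_add] at h0
      exact Prod.ext (Subtype.ext ha) (Prod.ext (Subtype.ext hb) (Subtype.ext h0))
    · intro z
      have hz : z ∈ p ⊔ (q ⊔ r) := by rw [hp.sup_eq_top]; trivial
      obtain ⟨a, ha, y, hy, rfl⟩ := Submodule.mem_sup.1 hz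
      obtain ⟨b, hb, c, hc, rfl⟩ := Submodule.mem_sup.1 hy
      exact ⟨(⟨a, ha⟩, (⟨b, hb⟩, ⟨c, hc⟩)), hf _ _ _⟩
  let e := LinearEquiv.ofBijective f hbij
  have he : ∀ x, e.symm (M x) = (M.restrict hpM).prodMap
      ((M.restrict hqM).prodMap (M.restrict hrM)) (e.symm x) := by
    intro x
    rw [LinearEquiv.symm_apply_eq]
    obtain ⟨⟨a, b, c⟩, rfl⟩ := e.surjective x
    rw [e.symm_apply_apply]
    change M (f _) = f _
    simp [hf]
  exact of_equiv e.symm he (prod (h (e.symm u).1) (h' (e.symm u).2))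

/-- The swap `(a, b) ↦ (k' b, k a)` is an involution even if `k` is not. As `M - μ` is onto on both
summands, every class contains the fixed vector 0. -/
theorem HasAdaptedRealStructure.of_swap {V : Type*} [AddCommGroup V] [Module ℂ V]
    {M : Module.End ℂ V} {k : V →ₛₗ[starRingEnd ℂ] V} {k' : V →ₛₗ[starRingEnd ℂ] V}
    (hkk' : ∀ x, k (k' x) = x) (hk'k : ∀ x, k' (k x) = x)
    (hk : ∀ x, k (M x) = M (k x)) (hk' : ∀ x, k' (M x) = M (k' x)) {q r : Submodule ℂ V}
    (hqM : ∀ x ∈ q, M x ∈ q) (hrM : ∀ x ∈ r, M x ∈ r) (hqr : ∀ x ∈ q, k x ∈ r)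
    (hrq : ∀ x ∈ r, k' x ∈ q) {μ : ℂ} (hq : ∀ u, ∃ w, M.restrict hqM w - μ • w = u)
    (hr : ∀ u, ∃ w, M.restrict hrM w - μ • w = u) (u : q × r) :
    HasAdaptedRealStructure ((M.restrict hqM).prodMap (M.restrict hrM)) μ u := by
  obtain ⟨w, hw⟩ := hq (-u.1)
  obtain ⟨w', hw'⟩ := hr (-u.2)
  refine ⟨{ toFun := fun p => (⟨k' p.2, hrq _ p.2.2⟩, ⟨k p.1, hqr _ p.1.2⟩),
            map_add' := fun a b => ?_, map_smul' := fun c a => ?_ }, fun x => ?_, fun x => ?_,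
          (w, w'), ?_⟩
  · ext <;> simp
  · ext <;> simp
  · ext <;> simp [hkk', hk'k]
  · ext <;> simp [hk, hk']
  · have : u + ((M.restrict hqM).prodMap (M.restrict hrM) (w, w') - μ • (w, w')) = 0 := by
      refine Prod.ext ?_ ?_
      · change u.1 + (M.restrict hqM w - μ • w) = 0
        rw [hw, add_neg_cancel]
      · change u.2 + (M.restrict hrM w' - μ • w') = 0
        rw [hw', add_neg_cancel]
    rw [this, map_zero]

theorem HasAdaptedRealStructure.of_antilinear {V : Type*} [AddCommGroup V] [Module ℂ V]
    [FiniteDimensional ℂ V] {M : Module.End ℂ V} {k : V →ₛₗ[starRingEnd ℂ] V}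
    {k' : V →ₛₗ[starRingEnd ℂ] V} (hkk' : ∀ x, k (k' x) = x) (hk'k : ∀ x, k' (k x) = x)
    (hk : ∀ x, k (M x) = M (k x)) {μ : ℂ} (hμ : starRingEnd ℂ μ = μ) (u : V) :
    HasAdaptedRealStructure M μ u := by
  have hk' : ∀ x, k' (M x) = M (k' x) := fun x => by
    rw [← hk'k (M (k' x)), hk, hkk']
  have hμ0 : μ.im = 0 := Complex.conj_eq_iff_im.1 hμ
  let P : Set ℂ := {l | 0 < l.im}
  let Q : Set ℂ := {l | l.im < 0}
  let R : Set ℂ := {l | l.im = 0}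
  have hPQ : Disjoint P Q := Set.disjoint_left.2 fun l (h : 0 < l.im) (h' : l.im < 0) =>
    lt_asymm h h'
  have hR : Disjoint R (P ∪ Q) := Set.disjoint_left.2 fun l (h : l.im = 0) h' =>
    h'.elim (fun h' : 0 < l.im => h'.ne' h) fun h' : l.im < 0 => h'.ne h
  have hU : R ∪ (P ∪ Q) = Set.univ := Set.eq_univ_of_forall fun l => by
    rcases lt_trichotomy l.im 0 with h | h | h
    · exact Or.inr (Or.inr h)
    · exact Or.inl h
    · exact Or.inr (Or.inl h)
  have hc : IsCompl (M.spectralPart R) (M.spectralPart P ⊔ M.spectralPart Q) := by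
    rw [← M.spectralPart_union]
    exact ⟨M.disjoint_spectralPart hR, codisjoint_iff.2 (by
      rw [← M.spectralPart_union, hU, M.spectralPart_univ])⟩
  refine of_disjoint_isCompl (M.disjoint_spectralPart hPQ) hc M.apply_mem_spectralPart
    M.apply_mem_spectralPart M.apply_mem_spectralPart (fun u => ?_) (fun u => ?_) u
  · refine of_real_spectrum _ (fun l hl => ?_) μ hμ u
    by_contra hl'
    obtain ⟨y, hy⟩ := hl.exists_hasEigenvector
    exact hy.2 (Subtype.ext (M.eq_zero_of_mem_spectralPart
      (fun h : l.im = 0 => hl' (Complex.conj_eq_iff_im.2 h)) y.2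
      (congrArg Subtype.val hy.apply_eq_smul)))
  · refine of_swap hkk' hk'k hk hk' _ _
      (M.antilinear_mem_spectralPart hk fun l (hl : 0 < l.im) => ?_)
      (M.antilinear_mem_spectralPart hk' fun l (hl : l.im < 0) => ?_)
      (M.exists_restrict_spectralPart_eq fun h : 0 < μ.im => h.ne' hμ0)
      (M.exists_restrict_spectralPart_eq fun h : μ.im < 0 => h.ne hμ0) u
    · change (starRingEnd ℂ l).im < 0
      simpa using hl
    · change 0 < (starRingEnd ℂ l).im
      simpa using hl

/-! ### The Cayley transform. -/

theorem exists_unimodular_sq_not_hasEigenvalue {V : Type*} [AddCommGroup V] [Module ℂ V]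
    [FiniteDimensional ℂ V] (A : Module.End ℂ V) :
    ∃ c : ℂ, c * starRingEnd ℂ c = 1 ∧ c ^ 2 ≠ 1 ∧ ¬ A.HasEigenvalue (c ^ 2) := by
  have hinf : Infinite Circle := by
    have : Infinite (Set.Ioc (-Real.pi) Real.pi) :=
      (Set.Ioc_infinite (by linarith [Real.pi_pos])).to_subtype
    exact Infinite.of_injective _ Circle.argEquiv.symm.injective
  have hfin : Set.Finite {l : ℂ | l = 1 ∨ A.HasEigenvalue l} :=
    (Set.finite_singleton (1 : ℂ)).union A.finite_hasEigenvalue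
  have hfin' : Set.Finite {z : Circle | (z : ℂ) = 1 ∨ A.HasEigenvalue (z : ℂ)} :=
    hfin.preimage Circle.coe_injective.injOn
  obtain ⟨z, hz⟩ := hfin'.exists_notMem
  have hz' : ¬ ((z : ℂ) = 1 ∨ A.HasEigenvalue (z : ℂ)) := hz
  have hsq : ((Circle.exp (Complex.arg z / 2) : Circle) : ℂ) ^ 2 = z := by
    rw [← Circle.coe_pow, sq, ← Circle.exp_add, add_halves, Circle.exp_arg]
  refine ⟨Circle.exp (Complex.arg z / 2), ?_, ?_, ?_⟩
  · rw [Complex.mul_conj, Circle.normSq_coe, Complex.ofReal_one]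
  · rw [hsq]; exact fun h => hz' (Or.inl h)
  · rw [hsq]; exact fun h => hz' (Or.inr h)

/-- If some antilinear bijection conjugates `A` to its inverse then so does an antilinear
involution, which can be adapted to any vector `v` modulo the range of `A - 1`. -/
theorem exists_antilinear_involution_reversing {V : Type*} [AddCommGroup V] [Module ℂ V]
    [FiniteDimensional ℂ V] {A : Module.End ℂ V} (hA : Function.Injective A)
    {k k' : V →ₛₗ[starRingEnd ℂ] V} (hkk' : ∀ x, k (k' x) = x) (hk'k : ∀ x, k' (k x) = x)
    (hk : ∀ x, A (k (A x)) = k x) (v : V) :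
    ∃ K : V →ₛₗ[starRingEnd ℂ] V, (∀ x, K (K x) = x) ∧ (∀ x, A (K (A x)) = K x) ∧
      ∃ w, A (K (v + (A w - w))) = -(v + (A w - w)) := by
  obtain ⟨c, hc, hc1, hcA⟩ := exists_unimodular_sq_not_hasEigenvalue A
  set ζ : ℂ := c ^ 2 with hζ
  have hζ' : ζ * starRingEnd ℂ ζ = 1 := by
    rw [hζ, map_pow, ← mul_pow, hc, one_pow]
  have hζ0 : ζ ≠ 0 := left_ne_zero_of_mul_eq_one hζ'
  have hbar : starRingEnd ℂ ζ = ζ⁻¹ := eq_inv_of_mul_eq_one_right hζ'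
  have hζ1 : ζ - 1 ≠ 0 := sub_ne_zero.2 hc1
  have hcζ : starRingEnd ℂ c * ζ = c := by
    rw [hζ]; linear_combination c * hc
  have hDinj : Function.Injective (algebraMap ℂ (Module.End ℂ V) ζ - A) := by
    rw [← LinearMap.ker_eq_bot, LinearMap.ker_eq_bot']
    intro x hx
    by_contra hx0
    refine hcA (Module.End.hasEigenvalue_of_hasEigenvector (x := x)
      ⟨Module.End.mem_eigenspace_iff.2 ?_, hx0⟩)
    have : ζ • x - A x = 0 := hx
    exact (sub_eq_zero.1 this).symm
  let D := LinearEquiv.ofInjectiveEndo _ hDinj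
  let E : Module.End ℂ V := D.symm.toLinearMap
  have hD : ∀ x, D x = ζ • x - A x := fun x => rfl
  have hED : ∀ x, E (ζ • x - A x) = x := fun x => by
    rw [← hD]; exact D.symm_apply_apply x
  have hAE : ∀ x, A (E x) = ζ • E x - x := fun x => by
    have : ζ • E x - A (E x) = x := by rw [← hD]; exact D.apply_symm_apply x
    rw [eq_sub_iff_add_eq, ← eq_sub_iff_add_eq', this]
  have hEA : ∀ x, E (A x) = ζ • E x - x := fun x => by
    have := hED x
    rw [map_sub, map_smul] at this
    rw [eq_sub_iff_add_eq, ← eq_sub_iff_add_eq', this]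
  -- This is `i(ζ + A)(ζ - A)⁻¹`, written as a polynomial in the resolvent `E`.
  let M : Module.End ℂ V := (2 * Complex.I * ζ) • E - algebraMap ℂ _ Complex.I
  have hM : ∀ x, M x = (2 * Complex.I * ζ) • E x - Complex.I • x := fun x => rfl
  have hkM : ∀ x, k (M x) = M (k x) := by
    intro y
    obtain ⟨z, rfl⟩ := D.surjective y
    have h1 : A (k (ζ • z - A z)) = (-ζ⁻¹) • (ζ • k z - A (k z)) := by
      rw [map_sub, map_smulₛₗ, map_sub, map_smul, hk, hbar]
      match_scalars <;> field_simp
    have hAM : ∀ x, A (M x) = M (A x) := fun x => by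
      rw [hM, hM, map_sub, map_smul, map_smul, hAE, hEA]
    apply hA
    rw [hAM, hM (D z), hD, h1, hED, map_smul M, hM (ζ • k z - A (k z)), hED, map_sub k,
      map_smulₛₗ k, map_smulₛₗ k, map_sub A, map_smul A, map_smul A, h1]
    simp only [map_mul, Complex.conj_I, hbar, map_ofNat]
    match_scalars <;> field_simp <;> ring
  -- The Cayley image of the eigenvalue 1: `M - μ = 2iζ(ζ - 1)⁻¹ (A - 1) E`.
  let μ : ℂ := Complex.I * (ζ + 1) / (ζ - 1)
  have hμ : starRingEnd ℂ μ = μ := by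
    have h2 : ζ⁻¹ - 1 ≠ 0 := sub_ne_zero.2 fun h => hc1 (inv_eq_one.1 h)
    simp only [μ, map_div₀, map_mul, map_add, map_sub, map_one, Complex.conj_I, hbar]
    rw [div_eq_div_iff h2 hζ1]
    field_simp
    ring
  have hAsurj := LinearMap.injective_iff_surjective.1 hA
  -- The operator `c A E` carries vectors fixed by `K` to vectors negated by `A K`; the scalar `c`
  -- works because `c̄ ζ = c`.
  obtain ⟨u, hu⟩ : ∃ u, c • A (E u) = v := by
    obtain ⟨y, hy⟩ := hAsurj (c⁻¹ • v)
    refine ⟨D y, ?_⟩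
    have hc0 : c ≠ 0 := left_ne_zero_of_mul_eq_one hc
    rw [hD, hED, hy, smul_inv_smul₀ hc0]
  obtain ⟨K, hKK, hKM, w, hw⟩ := HasAdaptedRealStructure.of_antilinear hkk' hk'k hkM hμ u
  have hKE : ∀ z, K (E z) = -ζ • A (E (K z)) := by
    intro z
    have h := hKM z
    rw [hM, hM, map_sub, map_smulₛₗ, map_smulₛₗ] at h
    simp only [map_mul, Complex.conj_I, hbar, map_ofNat] at h
    rw [hAE]
    have h2 : (2 * Complex.I * ζ⁻¹) • K (E z) =
        (2 * Complex.I * ζ⁻¹) • (-ζ • (ζ • E (K z) - K z)) := by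
      have : (2 * Complex.I * ζ⁻¹) • K (E z) =
          Complex.I • K z - ((2 * Complex.I * ζ) • E (K z) - Complex.I • K z) := by
        rw [← h]; module
      rw [this]
      match_scalars <;> field_simp <;> ring
    exact smul_right_injective V (by simp [hζ0] : 2 * Complex.I * ζ⁻¹ ≠ 0) h2
  have hKAE : ∀ z, K (A (E z)) = -ζ • E (K z) := by
    intro z
    rw [hAE, map_sub, map_smulₛₗ, hKE, hAE, hbar]
    match_scalars
    · field_simp
    · field_simp
      ring
  -- The witness is what makes `(A - 1)` of it equal `c A E (M - μ) w`.
  refine ⟨K, hKK, fun x => ?_, ((2 * Complex.I * ζ) * (ζ - 1)⁻¹ * c) • A (E (E w)), ?_⟩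
  · obtain ⟨z, rfl⟩ := D.symm.surjective x
    change A (K (A (E z))) = K (E z)
    rw [hKAE, hKE, map_smul]
  · set u' := u + (M w - μ • w) with hu'
    have hv : v + (A (((2 * Complex.I * ζ) * (ζ - 1)⁻¹ * c) • A (E (E w))) -
        ((2 * Complex.I * ζ) * (ζ - 1)⁻¹ * c) • A (E (E w))) = c • A (E u') := by
      rw [hu', ← hu, hM]
      simp only [map_add, map_sub, map_smul, hAE, μ]
      match_scalars <;> field_simp <;> ring
    rw [hv, map_smulₛₗ, hKAE, hw, map_smul, map_smul, smul_smul, ← smul_neg, mul_neg, hcζ]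
    simp

/-! ### Translation back to affine maps. -/

namespace Aff

variable {n : ℕ}

theorem mul_apply_eq_comp (g h : Aff n) (x : Fin n → ℂ) : (g * h) x = g (h x) := rfl

theorem glEquiv_conjGL_apply (A : GL (Fin n) ℂ) (x : Fin n → ℂ) :
    glEquiv n (conjGL A) x = star (glEquiv n A (star x)) := by
  funext i
  simp [glEquiv_apply, conjGL, Matrix.mulVec, dotProduct]

theorem conj_apply (g : Aff n) (x : Fin n → ℂ) : conj g x = star (g (star x)) := by
  obtain ⟨A, v, rfl⟩ : ∃ A v, g = mk A v := ⟨_, _, (mk_parts g).symm⟩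
  rw [conj_mk, mk_apply, mk_apply, star_add, ← glEquiv_apply, glEquiv_conjGL_apply, glEquiv_apply]

theorem conj_conj (g : Aff n) : conj (conj g) = g := by
  ext1 x; simp [conj_apply]

theorem conj_mul (g h : Aff n) : conj (g * h) = conj g * conj h := by
  ext1 x; simp [conj_apply, mul_apply_eq_comp]

theorem linearPart_mul (g h : Aff n) : linearPart (g * h) = linearPart g * linearPart h := by
  rw [linearPart, linearPart, linearPart, ← map_mul]; rfl

theorem linearPart_one : linearPart (1 : Aff n) = 1 := by
  rw [linearPart]; exact map_one _

theorem linearPart_inv (g : Aff n) : linearPart g⁻¹ = (linearPart g)⁻¹ := by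
  rw [eq_inv_iff_mul_eq_one, ← linearPart_mul, inv_mul_cancel, linearPart_one]

theorem linearPart_conj (g : Aff n) : linearPart (conj g) = conjGL (linearPart g) :=
  linearPart_mk _ _

theorem IsCReversible.linearPart {g : Aff n} (h : IsCReversible g) :
    IsCReversibleGL (linearPart g) := by
  obtain ⟨h, hh⟩ := h
  refine ⟨h.linearPart, ?_⟩
  rw [← linearPart_conj, ← linearPart_inv, ← linearPart_inv, ← hh, linearPart_mul, linearPart_mul]

theorem IsStronglyCReversible.exists_mul {g : Aff n} (h : IsStronglyCReversible g) :
    ∃ a b : Aff n, IsConinvolution a ∧ IsConinvolution b ∧ g = a * b := by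
  obtain ⟨h, hg, hh⟩ := h
  have hh' : conj h = h⁻¹ := eq_inv_of_mul_eq_one_right hh
  refine ⟨h⁻¹, h * g, ?_, ?_, by group⟩
  · rw [IsConinvolution, ← hh', conj_conj, hh', inv_mul_cancel]
  · rw [IsConinvolution, conj_mul, hh', ← mul_assoc, hg, inv_mul_cancel]

theorem isCReversible_mul {a b : Aff n} (ha : IsConinvolution a) (hb : IsConinvolution b) :
    IsCReversible (a * b) := by
  have ha' : conj a = a⁻¹ := eq_inv_of_mul_eq_one_right ha
  have hb' : conj b = b⁻¹ := eq_inv_of_mul_eq_one_right hb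
  refine ⟨b, ?_⟩
  rw [conj_mul, ha', hb']
  group

/-- The affine map `x ↦ conj (k (x - w) + w)` attached to an antilinear involution `k`. -/
theorem exists_apply_eq_star {k : (Fin n → ℂ) →ₛₗ[starRingEnd ℂ] (Fin n → ℂ)}
    (hk : ∀ x, k (k x) = x) (w : Fin n → ℂ) :
    ∃ h : Aff n, ∀ x, h x = star (k (x - w) + w) := by
  let L : (Fin n → ℂ) ≃ₗ[ℂ] (Fin n → ℂ) :=
    { toFun := fun x => star (k x)
      invFun := fun x => k (star x)
      map_add' := fun x y => by simp
      map_smul' := fun c x => by simp [map_smulₛₗ]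
      left_inv := fun x => by simp [hk]
      right_inv := fun x => by simp [hk] }
  refine ⟨AffineEquiv.mk' (fun x => star (k (x - w) + w)) L w fun x => ?_, fun x => rfl⟩
  change star (k (x - w) + w) = star (k (x - w)) + star (k (w - w) + w)
  simp

theorem IsCReversibleGL.isStronglyCReversible {g : Aff n}
    (h : IsCReversibleGL (Aff.linearPart g)) : IsStronglyCReversible g := by
  obtain ⟨A, v, rfl⟩ : ∃ A v, g = mk A v := ⟨_, _, (mk_parts g).symm⟩
  rw [linearPart_mk] at h
  obtain ⟨B, hB⟩ := h
  -- With `k = conj ∘ B`, the hypothesis on `B` reads `k = A k A`.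
  have hBA : ∀ x, star (glEquiv n B x) = glEquiv n A (star (glEquiv n B (glEquiv n A x))) := by
    intro x
    have h : conjGL A * B * A = B := by
      rw [← mul_inv_eq_one, mul_assoc, mul_assoc, ← mul_assoc B, hB, mul_inv_cancel]
    conv_lhs => rw [← h]
    rw [map_mul, map_mul, LinearEquiv.mul_apply, LinearEquiv.mul_apply, glEquiv_conjGL_apply, star_star]
  let k : (Fin n → ℂ) →ₛₗ[starRingEnd ℂ] (Fin n → ℂ) :=
    { toFun := fun x => star (glEquiv n B x)
      map_add' := fun x y => by simp
      map_smul' := fun c x => by simp }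
  let k' : (Fin n → ℂ) →ₛₗ[starRingEnd ℂ] (Fin n → ℂ) :=
    { toFun := fun x => (glEquiv n B).symm (star x)
      map_add' := fun x y => by simp
      map_smul' := fun c x => by simp }
  obtain ⟨K, hKK, hKA, w, hw⟩ := exists_antilinear_involution_reversing
    (A := (glEquiv n A).toLinearMap) (k := k) (k' := k') (glEquiv n A).injective
    (fun x => by simp [k, k']) (fun x => by simp [k, k']) (fun x => (hBA x).symm) v
  set a := (glEquiv n A).toLinearMap
  obtain ⟨f, hf⟩ := exists_apply_eq_star hKK w
  have hg : ∀ x, mk A v x = a x + v := fun x => rfl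
  refine ⟨f, ?_, ?_⟩
  · apply eq_inv_of_mul_eq_one_right
    rw [← mul_assoc, ← mul_assoc, mul_inv_eq_one]
    ext1 x
    -- Recentring at `w` replaces the translation part by `v + (a w - w)`, the vector that `a K`
    -- negates.
    have hx : a x + v - w = a (x - w) + (v + (a w - w)) := by rw [map_sub]; abel
    rw [mul_apply_eq_comp, mul_apply_eq_comp, conj_apply, hf, hf, star_star, hg, hg, hx, map_add a, map_add K,
      map_add a, hKA, hw]
    congr 1
    abel
  · rw [IsConinvolution]
    ext1 x
    rw [mul_apply_eq_comp, conj_apply, hf, hf]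
    simp [hKK]

end Aff

theorem theorem1 (n : ℕ) (g : Aff n) :
    List.TFAE
      [Aff.IsCReversible g,
       Aff.IsStronglyCReversible g,
       ∃ a b : Aff n, Aff.IsConinvolution a ∧ Aff.IsConinvolution b ∧ g = a * b,
       Aff.IsCReversibleGL (Aff.linearPart g)] := by
  tfae_have 1 → 4 := fun h => h.linearPart
  tfae_have 4 → 2 := fun h => h.isStronglyCReversible
  tfae_have 2 → 3 := fun h => h.exists_mul
  tfae_have 3 → 1 := by
    rintro ⟨a, b, ha, hb, rfl⟩
    exact Aff.isCReversible_mul ha hb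
  tfae_finish
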